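/- Let $\mathbb F_q$ be a finite field with $q$ elements, let $K\ge 2$, and assume that $q\ge 3$ or $K=2$. Let $0\le\rho\le 1$, and let $Z$ be the random element of $\mathbb F_q$ with $\Pr(Z=0)=1-\rho$ and $\Pr(Z=z)=\rho/(q-1)$ for each $z\ne 0$; let $H(Z)$ be its entropy in bits. Consider the $K$-user finite-field interference channel: at time $t$ receiver $k$ observes $$Y_k(t)=\sum_{\ell=1}^K h_{k\ell}(t)X_\ell(t)+Z_k(t)\in\mathbb F_q ,$$ where the $h_{k\ell}(t)$ are independent over all $k,\ell,t$ and uniform on $\mathbb F_q\setminus\{0\}$, the $Z_k(t)$ are independent over all $k,t$ and distributed as $Z$, and messages, channel coefficients and noise are independent. Just before time $t$ all transmitters and receivers learn the matrix $\mathbf H(t)=(h_{k\ell}(t))_{k,\ell}$. In a code of block length $n$ and rates $\tilde R_1,\dots,\tilde R_K\ge 0$, the message $w_k$ is uniform on the integers in $[1,2^{n\tilde R_k}]$, the messages are independent, transmitter $k$ sends at time $t$ a symbol that is a function of $w_k,\mathbf H(1),\dots,\mathbf H(t)$, and receiver $k$ forms an estimate $\hat w_k$ of $w_k$ as a function of $Y_k(1),\dots,Y_k(n),\mathbf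 H(1),\dots,\mathbf H(n)$. A tuple $(R_1,\dots,R_K)$ of nonnegative reals is achievable if for every $\epsilon>0$ and all sufficiently large $n$ there is such a code with $\tilde R_k>R_k-\epsilon$ for all $k$ and $\Pr(\hat w_k\ne w_k\text{ for some }k)<\epsilon$. The ergodic capacity region is the closure of the set of achievable tuples. Then the ergodic capacity region is exactly $$\bigl\{(R_1,\dots,R_K)\in\mathbb R_{\ge0}^K:\ R_k+R_\ell\le\log_2 q-H(Z)\ \text{ for all } k\ne\ell\bigr\}.$$ -/

import Mathlib

open scoped BigOperators

noncomputable section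

namespace FiniteFieldIC

/-- A realization of the channel matrix at one time step: its entry `h k l`, the coefficient from
transmitter `l` to receiver `k`, is a nonzero element of the finite field `F`. -/
abbrev ChannelState (F : Type*) [Field F] (K : ℕ) : Type _ :=
  Fin K → Fin K → Fˣ

/-- The law of a single noise symbol: with probability `ρ` it is uniform on the `q - 1` nonzero
elements of `F`, and otherwise it is zero. -/
def noiseProb {F : Type*} [Field F] [Fintype F] [DecidableEq F] (ρ : ℝ) (z : F) : ℝ :=
  if z = 0 then 1 - ρ else ρ / ((Fintype.card F : ℝ) - 1)

/-- The entropy `H(Z)`, in bits, of a noise symbol. -/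
def noiseEntropy (F : Type*) [Field F] [Fintype F] [DecidableEq F] (ρ : ℝ) : ℝ :=
  -∑ z : F, noiseProb ρ z * Real.logb 2 (noiseProb ρ z)

/-- A code of block length `n` for the `K`-user interference channel over `F`, where user `k` has
`M k` messages. Transmitters and receivers learn the channel matrix of each time step just before
that step, so the symbol sent at time `t` depends on the transmitter's own message and on the
channel matrices up to time `t` only. A receiver decodes from its `n` channel outputs and the
whole sequence of channel matrices. -/
structure Code (F : Type*) [Field F] (K n : ℕ) (M : Fin K → ℕ) where
  /-- `enc k w H t` is the symbol sent by transmitter `k` at time `t`. -/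
  enc : (k : Fin K) → Fin (M k) → (Fin n → ChannelState F K) → Fin n → F
  causal : ∀ (k : Fin K) (w : Fin (M k)) (H H' : Fin n → ChannelState F K) (t : Fin n),
    (∀ s ≤ t, H s = H' s) → enc k w H t = enc k w H' t
  /-- `dec k H y` is the message decided on by receiver `k`. -/
  dec : (k : Fin K) → (Fin n → ChannelState F K) → (Fin n → F) → Fin (M k)

/-- The output `Y_k(t) = ∑ l, h_{k l}(t) X_l(t) + Z_k(t)` at receiver `k` and time `t`. -/
def channelOutput {F : Type*} [Field F] {K n : ℕ} (H : Fin n → ChannelState F K)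
    (x z : Fin K → Fin n → F) (k : Fin K) (t : Fin n) : F :=
  ∑ l : Fin K, (H t k l : F) * x l t + z k t

/-- The event that some receiver decodes its message wrongly, for the messages `w`, the channel
matrices `H` and the noise `z`. -/
def Code.Fails {F : Type*} [Field F] {K n : ℕ} {M : Fin K → ℕ} (c : Code F K n M)
    (w : (k : Fin K) → Fin (M k)) (H : Fin n → ChannelState F K) (z : Fin K → Fin n → F) : Prop :=
  ∃ k : Fin K, c.dec k H (channelOutput H (fun l => c.enc l (w l) H) z k) ≠ w k

open Classical in
/-- The probability that some receiver decodes its message wrongly. The messages are independent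
and uniform, the channel coefficients are independent over all times and all pairs and uniform on
the nonzero elements (so both tuples are uniform, and `𝔼` is the uniform average), the noise
symbols are independent over all times and receivers, and messages, channel and noise are
independent. -/
def Code.errorProb {F : Type*} [Field F] [Fintype F] [DecidableEq F] {K n : ℕ} {M : Fin K → ℕ}
    (c : Code F K n M) (ρ : ℝ) : ℝ :=
  𝔼 w : (k : Fin K) → Fin (M k), 𝔼 H : Fin n → ChannelState F K,
    ∑ z : Fin K → Fin n → F,
      (∏ k : Fin K, ∏ t : Fin n, noiseProb ρ (z k t)) * (if c.Fails w H z then 1 else 0)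

/-- Achievability of an ergodic rate tuple. The message set `{1, 2, …, 2 ^ (n * R')}` of a user
of rate `R' ≥ 0` has `⌊2 ^ (n * R')⌋` elements. -/
def Achievable (F : Type*) [Field F] [Fintype F] [DecidableEq F] (K : ℕ) (ρ : ℝ)
    (R : Fin K → ℝ) : Prop :=
  ∀ ε : ℝ, 0 < ε → ∃ N : ℕ, ∀ n : ℕ, N ≤ n →
    ∃ R' : Fin K → ℝ, (∀ k, 0 ≤ R' k ∧ R k - ε < R' k) ∧
      ∃ c : Code F K n (fun k => ⌊(2 : ℝ) ^ ((n : ℝ) * R' k)⌋₊), c.errorProb ρ < ε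

/-- The ergodic capacity region: the closure of the set of all achievable ergodic rate tuples
(rates are nonnegative). -/
def ergodicCapacityRegion (F : Type*) [Field F] [Fintype F] [DecidableEq F] (K : ℕ) (ρ : ℝ) :
    Set (Fin K → ℝ) :=
  closure {R : Fin K → ℝ | (∀ k, 0 ≤ R k) ∧ Achievable F K ρ R}

end FiniteFieldIC

end

/-! Write C = log₂ q − H(Z). Converse: let receiver k know all messages except those of users k and
l. It decodes w_k from its output, removes the known terms, and rescales by h_ll / h_kl. This
reproduces the output of receiver l with rescaled noise, and the noise law is invariant under
nonzero scaling, so w_l can be decoded as well. The pairs (messages, noise) for which both decodings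
succeed are therefore determined by the output at k and the remaining messages
(`Code.jointSuccess_injective`). Counting them, and using that a noise sequence is rarely much
likelier than 2^(−nH), gives `Code.converse_bound` and then `Achievable.add_le`.

Achievability: pair each channel state with the one whose direct coefficients are multiplied by α
and whose cross coefficients are negated. If the same vectors are sent in both, the two received
combinations add up to (1 + α) h_kk times the desired vector, which is useful when α ≠ 0, −1; such α
exists for q ≥ 3. Every user then gets C/2 at once, and time sharing with single-user transmission
fills the region (`exists_time_sharing`). For K = 2 time sharing alone suffices. Each receiver
decodes the linear combinations themselves before adding them, so noise does not accumulate. A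
random linear code does this: the normalized likelihood of a true combination grows like 2^(C ·
number of slots), while that of each false one has mean 1 (`exists_errorProb_lt`). Streams are
indexed by channel state and repeated in a second phase, so an encoder needs only the current
matrix. -/

open scoped BigOperators

noncomputable section

namespace FiniteFieldIC

/-! ### Chernoff bounds and marginals of product weights -/

section Weights

/-- A Chernoff factor for a random variable whose mean lies below `m`. -/
theorem exists_sum_mul_exp_lt_one {A : Type*} [Fintype A] (p f : A → ℝ) (hp1 : ∑ a, p a = 1)
    {m : ℝ} (hm : ∑ a, p a * f a < m) :
    ∃ s : ℝ, 0 < s ∧ ∑ a, p a * Real.exp (s * (f a - m)) < 1 := by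
  -- The exponential moment equals 1 at `s = 0` and its derivative there is the mean minus `m`,
  -- which is negative.
  have hG : HasDerivAt (fun s : ℝ => ∑ a, p a * Real.exp (s * (f a - m)) - 1)
      (∑ a, p a * (f a - m)) 0 := by
    refine HasDerivAt.sub_const _ (HasDerivAt.fun_sum fun a _ => ?_)
    have h : HasDerivAt (fun s : ℝ => Real.exp (s * (f a - m)))
        (Real.exp (0 * (f a - m)) * (1 * (f a - m))) 0 :=
      ((hasDerivAt_id (0 : ℝ)).mul_const (f a - m)).exp
    simpa using h.const_mul (p a)
  have hneg : ∑ a, p a * (f a - m) < 0 := by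
    simp only [mul_sub, Finset.sum_sub_distrib, ← Finset.sum_mul, hp1]
    linarith
  have hev := eventually_nhdsWithin_sign_eq_of_deriv_neg (x₀ := 0) (by rw [hG.deriv]; exact hneg)
    (by simp [hp1])
  have hev' := hev.filter_mono (nhdsWithin_le_nhds (s := Set.Ioi (0 : ℝ)))
  obtain ⟨s, hs, hs0⟩ := (hev'.and self_mem_nhdsWithin).exists
  have hs0' : (0 : ℝ) < s := hs0
  refine ⟨s, hs0', ?_⟩
  rw [sign_neg (show (0 : ℝ) - s < 0 by linarith)] at hs
  have := sign_eq_neg_one_iff.1 hs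
  linarith

/-- Exponential decay of the upper tail of a sum of independent identically distributed terms. -/
theorem exists_tail_le_pow {A : Type*} [Fintype A] (p f : A → ℝ) (hp : ∀ a, 0 ≤ p a)
    (hp1 : ∑ a, p a = 1) {m : ℝ} (hm : ∑ a, p a * f a < m) :
    ∃ r : ℝ, 0 ≤ r ∧ r < 1 ∧ ∀ n : ℕ,
      ∑ x : Fin n → A, (∏ t, p (x t)) * (if n * m ≤ ∑ t, f (x t) then 1 else 0) ≤ r ^ n := by
  obtain ⟨s, hs, hlt⟩ := exists_sum_mul_exp_lt_one p f hp1 hm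
  refine ⟨_, Finset.sum_nonneg fun a _ => mul_nonneg (hp a) (Real.exp_pos _).le, hlt, fun n => ?_⟩
  -- Expanded over sequences, the `n`-th power dominates the indicator term by term.
  rw [Fintype.sum_pow]
  refine Finset.sum_le_sum fun x _ => ?_
  rw [Finset.prod_mul_distrib, ← Real.exp_sum]
  refine mul_le_mul_of_nonneg_left ?_ (Finset.prod_nonneg fun t _ => hp _)
  split_ifs with h
  · rw [← Finset.mul_sum, Finset.sum_sub_distrib]
    simp only [Finset.sum_const, Finset.card_univ, Fintype.card_fin, nsmul_eq_mul]
    exact Real.one_le_exp (mul_nonneg hs.le (by linarith))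
  · exact (Real.exp_pos _).le

/-- Marginalization of a product weight to one coordinate. -/
theorem sum_prod_mul_eval {ι X : Type*} [Fintype ι] [DecidableEq ι] [Fintype X] (w : X → ℝ)
    (hw : ∑ x, w x = 1) (i : ι) (f : X → ℝ) :
    ∑ z : ι → X, (∏ k, w (z k)) * f (z i) = ∑ x, w x * f x := by
  have h := Fintype.prod_sum (fun (k : ι) (x : X) => w x * if k = i then f x else 1)
  have h1 : ∀ z : ι → X, ∏ k, (w (z k) * if k = i then f (z k) else 1)
      = (∏ k, w (z k)) * f (z i) := fun z => by
    rw [Finset.prod_mul_distrib]; simp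
  rw [Finset.sum_congr rfl fun z _ => h1 z] at h
  rw [← h, Finset.prod_eq_single i]
  · simp
  · intro b _ hb; simp [hb, hw]
  · simp

end Weights

theorem one_lt_card_real {F : Type*} [Field F] [Fintype F] : (1 : ℝ) < Fintype.card F := by
  exact_mod_cast Fintype.one_lt_card

/-! ### The noise law and its typical likelihood -/

section Noise

variable {F : Type*} [Field F] [Fintype F] [DecidableEq F] {ρ : ℝ}

theorem noiseProb_nonneg (h0 : 0 ≤ ρ) (h1 : ρ ≤ 1) (z : F) : 0 ≤ noiseProb ρ z := by
  have := one_lt_card_real (F := F)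
  unfold noiseProb
  split_ifs
  · linarith
  · exact div_nonneg h0 (by linarith)

theorem sum_noiseProb (ρ : ℝ) : ∑ z : F, noiseProb ρ z = 1 := by
  have h := one_lt_card_real (F := F)
  have h' : (Fintype.card F : ℝ) - 1 ≠ 0 := by linarith
  rw [← Finset.add_sum_erase _ _ (Finset.mem_univ (0 : F))]
  have : ∀ z ∈ Finset.univ.erase (0 : F), noiseProb ρ z = ρ / ((Fintype.card F : ℝ) - 1) :=
    fun z hz => if_neg (Finset.ne_of_mem_erase hz)
  rw [Finset.sum_congr rfl this, Finset.sum_const, Finset.card_erase_of_mem (Finset.mem_univ _),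
    Finset.card_univ, nsmul_eq_mul, Nat.cast_sub Fintype.card_pos, Nat.cast_one,
    mul_div_cancel₀ _ h', noiseProb, if_pos rfl]
  ring

theorem noiseProb_mul {a : F} (ha : a ≠ 0) (z : F) : noiseProb ρ (a * z) = noiseProb ρ z := by
  simp [noiseProb, ha]

/-- The law of a noise sequence. -/
def seqProb (ρ : ℝ) {n : ℕ} (z : Fin n → F) : ℝ := ∏ t, noiseProb ρ (z t)

theorem seqProb_nonneg (h0 : 0 ≤ ρ) (h1 : ρ ≤ 1) {n : ℕ} (z : Fin n → F) : 0 ≤ seqProb ρ z :=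
  Finset.prod_nonneg fun _ _ => noiseProb_nonneg h0 h1 _

theorem sum_seqProb (ρ : ℝ) (n : ℕ) : ∑ z : Fin n → F, seqProb ρ z = 1 := by
  have := Fintype.sum_pow (noiseProb (F := F) ρ) n
  rw [sum_noiseProb, one_pow] at this
  exact this.symm

theorem logb_seqProb {n : ℕ} {z : Fin n → F} (hz : seqProb ρ z ≠ 0) :
    Real.logb 2 (seqProb ρ z) = ∑ t, Real.logb 2 (noiseProb ρ (z t)) :=
  Real.logb_prod _ _ fun t ht => (Finset.prod_ne_zero_iff.1 hz) t ht

/-- The probability that a noise sequence is more likely than its entropy suggests. -/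
theorem exists_seqProb_tail_le (h0 : 0 ≤ ρ) (h1 : ρ ≤ 1) {δ : ℝ} (hδ : 0 < δ) :
    ∃ r : ℝ, 0 ≤ r ∧ r < 1 ∧ ∀ n : ℕ,
      ∑ z : Fin n → F, seqProb ρ z *
        (if (2 : ℝ) ^ (n * (-noiseEntropy F ρ + δ)) < seqProb ρ z then 1 else 0) ≤ r ^ n := by
  obtain ⟨r, hr0, hr1, hr⟩ := exists_tail_le_pow (noiseProb (F := F) ρ)
    (fun z => Real.logb 2 (noiseProb ρ z)) (noiseProb_nonneg h0 h1) (sum_noiseProb ρ)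
    (m := -noiseEntropy F ρ + δ) (by rw [noiseEntropy]; linarith)
  refine ⟨r, hr0, hr1, fun n => le_trans (Finset.sum_le_sum fun z _ => ?_) (hr n)⟩
  refine mul_le_mul_of_nonneg_left ?_ (seqProb_nonneg h0 h1 z)
  split_ifs with h h'
  · exact le_rfl
  · exfalso
    -- Sequences of probability zero, where the logarithm takes its default value, are excluded by
    -- the strict inequality.
    have hpos : 0 < seqProb ρ z := lt_trans (by positivity) h
    rw [← logb_seqProb hpos.ne', Real.le_logb_iff_rpow_le one_lt_two hpos] at h'
    exact h' h.le
  · exact zero_le_one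
  · exact le_rfl

end Noise

section ErrorProb

variable {F : Type*} [Field F] [Fintype F] [DecidableEq F] {ρ : ℝ} {K n : ℕ} {M : Fin K → ℕ}

open Classical in
theorem Code.errorProb_eq (c : Code F K n M) :
    c.errorProb ρ = (∑ w : (k : Fin K) → Fin (M k), ∑ H : Fin n → ChannelState F K,
      ∑ z : Fin K → Fin n → F, (∏ k, seqProb ρ (z k)) * (if c.Fails w H z then 1 else 0)) /
      ((∏ k, (M k : ℝ)) * Fintype.card (Fin n → ChannelState F K)) := by
  simp only [Code.errorProb, Fintype.expect_eq_sum_div_card, ← Finset.sum_div, div_div, seqProb]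
  congr 1
  rw [mul_comm]
  simp [Fintype.card_pi]

end ErrorProb

/-! ### Converse: the genie-aided receiver and the counting bound -/

section Converse

variable {F : Type*} [Field F] [Fintype F] [DecidableEq F] {ρ : ℝ} {K n : ℕ} {M : Fin K → ℕ}

/-- The noiseless part of the output at receiver `k`. -/
def Code.signal (c : Code F K n M) (w : (k : Fin K) → Fin (M k)) (H : Fin n → ChannelState F K)
    (k : Fin K) (t : Fin n) : F :=
  ∑ m : Fin K, (H t k m : F) * c.enc m (w m) H t

/-- Both messages of the users `k` and `l` are decoded correctly by a genie-aided receiver `k` that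
rescales its noise `z` to simulate the output of receiver `l`. -/
def Code.JointSuccess (c : Code F K n M) (k l : Fin K) (w : (k : Fin K) → Fin (M k))
    (H : Fin n → ChannelState F K) (z : Fin n → F) : Prop :=
  c.dec k H (fun t => c.signal w H k t + z t) = w k ∧
  c.dec l H (fun t => c.signal w H l t + (H t l l : F) / (H t k l : F) * z t) = w l

/-- The noise law distinguishes only zero from nonzero, so coordinatewise nonzero scaling permutes
the sequences and preserves their weights. This lets receiver k imitate receiver l. -/
theorem sum_seqProb_comp_mul {a : Fin n → F} (ha : ∀ t, a t ≠ 0) (f : (Fin n → F) → ℝ) :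
    ∑ z : Fin n → F, seqProb ρ z * f (fun t => a t * z t) = ∑ z : Fin n → F, seqProb ρ z * f z := by
  refine Fintype.sum_equiv (Equiv.piCongrRight fun t => Equiv.mulLeft₀ (a t) (ha t)) _ _ fun z => ?_
  congr 1
  exact Finset.prod_congr rfl fun t _ => (noiseProb_mul (ha t) _).symm

open Classical in
theorem Code.sum_decode_ne_le (h0 : 0 ≤ ρ) (h1 : ρ ≤ 1) (c : Code F K n M)
    (w : (k : Fin K) → Fin (M k)) (H : Fin n → ChannelState F K) (k : Fin K) :
    ∑ z : Fin n → F, seqProb ρ z *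
        (if c.dec k H (fun t => c.signal w H k t + z t) ≠ w k then 1 else 0) ≤
      ∑ z : Fin K → Fin n → F, (∏ k, seqProb ρ (z k)) * (if c.Fails w H z then 1 else 0) := by
  rw [← sum_prod_mul_eval (seqProb ρ) (sum_seqProb ρ n) k]
  refine Finset.sum_le_sum fun z _ => mul_le_mul_of_nonneg_left ?_
    (Finset.prod_nonneg fun k _ => seqProb_nonneg h0 h1 _)
  split_ifs with h h' h'
  · exact le_rfl
  · exact absurd ⟨k, h⟩ h'
  · exact zero_le_one
  · exact le_rfl

-- A union bound over the two decoders. Only the marginal law of each receiver's noise enters, so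
-- one sequence, suitably rescaled, can serve both.
open Classical in
theorem Code.one_sub_le_sum_jointSuccess (h0 : 0 ≤ ρ) (h1 : ρ ≤ 1) (c : Code F K n M)
    (w : (k : Fin K) → Fin (M k)) (H : Fin n → ChannelState F K) (k l : Fin K) :
    1 - 2 * ∑ z : Fin K → Fin n → F,
        (∏ k, seqProb ρ (z k)) * (if c.Fails w H z then 1 else 0) ≤
      ∑ z : Fin n → F, seqProb ρ z * (if c.JointSuccess k l w H z then 1 else 0) := by
  have hk := c.sum_decode_ne_le h0 h1 w H k
  have hl := c.sum_decode_ne_le h0 h1 w H l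
  rw [← sum_seqProb_comp_mul (a := fun t => (H t l l : F) / (H t k l : F))
    (fun t => div_ne_zero (H t l l).ne_zero (H t k l).ne_zero)
    (fun z => if c.dec l H (fun t => c.signal w H l t + z t) ≠ w l then (1 : ℝ) else 0)] at hl
  have hs := sum_seqProb (F := F) ρ n
  have : ∑ z : Fin n → F, seqProb ρ z ≤ ∑ z : Fin n → F, (seqProb ρ z *
        (if c.dec k H (fun t => c.signal w H k t + z t) ≠ w k then 1 else 0) +
      seqProb ρ z * (if c.dec l H (fun t => c.signal w H l t +
        (H t l l : F) / (H t k l : F) * z t) ≠ w l then 1 else 0) +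
      seqProb ρ z * (if c.JointSuccess k l w H z then 1 else 0)) := by
    refine Finset.sum_le_sum fun z _ => ?_
    have hz := seqProb_nonneg h0 h1 z
    by_cases hA : c.dec k H (fun t => c.signal w H k t + z t) = w k
    · by_cases hB : c.dec l H (fun t => c.signal w H l t +
          (H t l l : F) / (H t k l : F) * z t) = w l
      · rw [if_pos (show c.JointSuccess k l w H z from ⟨hA, hB⟩)]
        simp [hA, hB]
      · rw [if_pos hB, mul_one, if_neg (not_not.2 hA)]
        split_ifs <;> linarith
    · rw [if_pos hA, mul_one]
      split_ifs <;> linarith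
  simp only [Finset.sum_add_distrib] at this
  linarith

omit [Fintype F] [DecidableEq F] in
/-- Given the output of receiver `k` and the messages of the other users, the joint decoder leaves
only one possibility. -/
theorem Code.jointSuccess_injective (c : Code F K n M) {k l : Fin K} (hkl : k ≠ l)
    (H : Fin n → ChannelState F K) {w w' : (k : Fin K) → Fin (M k)} {z z' : Fin n → F}
    (hs : c.JointSuccess k l w H z) (hs' : c.JointSuccess k l w' H z')
    (hy : ∀ t, c.signal w H k t + z t = c.signal w' H k t + z' t)
    (hw : ∀ m, m ≠ k → m ≠ l → w m = w' m) : w = w' ∧ z = z' := by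
  have hwk : w k = w' k := by
    rw [← hs.1, ← hs'.1]
    congr 1
    exact funext hy
  have hne : ∀ m, m ≠ l → w m = w' m := fun m hm => by
    by_cases hmk : m = k
    · subst hmk; exact hwk
    · exact hw m hmk hm
  have hwl : w l = w' l := by
    rw [← hs.2, ← hs'.2]
    congr 1
    funext t
    -- Subtracting this multiple of the signal at k cancels transmitter l; what remains depends only
    -- on messages already known to agree.
    have key : c.signal w H l t - (H t l l : F) / (H t k l : F) * c.signal w H k t =
        c.signal w' H l t - (H t l l : F) / (H t k l : F) * c.signal w' H k t := by
      simp only [Code.signal, Finset.mul_sum, ← Finset.sum_sub_distrib]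
      refine Finset.sum_congr rfl fun m _ => ?_
      by_cases hm : m = l
      · subst hm
        have := (H t k m).ne_zero
        field_simp
        ring
      · rw [hne m hm]
    linear_combination key + (H t l l : F) / (H t k l : F) * hy t
  have hww : w = w' := funext fun m => by
    by_cases hm : m = l
    · subst hm; exact hwl
    · exact hne m hm
  subst hww
  exact ⟨rfl, funext fun t => add_left_cancel (hy t)⟩

-- By injectivity, the successful pairs are at most as many as the pairs formed by an output at k
-- and the messages of the users other than k and l.
omit [DecidableEq F] in
open Classical in
theorem Code.sum_jointSuccess_le (c : Code F K n M) {k l : Fin K} (hkl : k ≠ l)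
    (H : Fin n → ChannelState F K) :
    (M k * M l : ℝ) * ∑ w : (k : Fin K) → Fin (M k), ∑ z : Fin n → F,
      (if c.JointSuccess k l w H z then (1 : ℝ) else 0) ≤
      (∏ k, (M k : ℝ)) * (Fintype.card F : ℝ) ^ n := by
  let S : Finset (((k : Fin K) → Fin (M k)) × (Fin n → F)) :=
    Finset.univ.filter fun x => c.JointSuccess k l x.1 H x.2
  have hcard : S.card ≤ Fintype.card
      ((Fin n → F) × ((m : {m : Fin K // m ≠ l ∧ m ≠ k}) → Fin (M m))) := by
    refine Finset.card_le_card_of_injOn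
      (fun x => (fun t => c.signal x.1 H k t + x.2 t, fun m => x.1 m))
      (fun _ _ => Finset.mem_coe.2 (Finset.mem_univ _)) ?_
    rintro ⟨w, z⟩ hx ⟨w', z'⟩ hx' h
    simp only [Finset.coe_filter, Finset.mem_univ, true_and, Set.mem_ofPred_eq, S] at hx hx'
    simp only [Prod.mk.injEq] at h
    obtain ⟨rfl, rfl⟩ := c.jointSuccess_injective hkl H hx hx' (congrFun h.1) fun m hk hl =>
      congrFun h.2 ⟨m, hl, hk⟩
    rfl
  have hsum : ∑ w : (k : Fin K) → Fin (M k), ∑ z : Fin n → F,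
      (if c.JointSuccess k l w H z then (1 : ℝ) else 0) = S.card := by
    rw [← Fintype.sum_prod_type', Finset.sum_boole]
  have hprod : (∏ k, (M k : ℝ)) = M k * M l *
      ∏ m ∈ (Finset.univ.erase k).erase l, (M m : ℝ) := by
    rw [← Finset.mul_prod_erase _ _ (Finset.mem_univ k),
      ← Finset.mul_prod_erase (Finset.univ.erase k) _ (a := l) (by simp [hkl.symm]), mul_assoc]
  have hcard' : (S.card : ℝ) ≤ (Fintype.card F : ℝ) ^ n *
      ∏ m ∈ (Finset.univ.erase k).erase l, (M m : ℝ) := by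
    rw [Fintype.card_prod, Fintype.card_pi, Fintype.card_pi,
      ← Finset.prod_subtype ((Finset.univ.erase k).erase l) (by simp)
        fun m => Fintype.card (Fin (M m))] at hcard
    simp only [Finset.prod_const, Finset.card_univ, Fintype.card_fin] at hcard
    exact_mod_cast hcard
  rw [hsum, hprod]
  calc (M k * M l : ℝ) * S.card ≤ M k * M l * ((Fintype.card F : ℝ) ^ n *
      ∏ m ∈ (Finset.univ.erase k).erase l, (M m : ℝ)) := by gcongr
    _ = _ := by ring

/-- Two messages that are decoded reliably fit into the outputs of a single receiver. -/
theorem Code.converse_bound (h0 : 0 ≤ ρ) (h1 : ρ ≤ 1) (c : Code F K n M) (hM : ∀ k, 0 < M k)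
    {k l : Fin K} (hkl : k ≠ l) {τ : ℝ} (hτ : 0 ≤ τ) :
    (M k * M l : ℝ) * (1 - 2 * c.errorProb ρ) ≤
      (M k * M l : ℝ) * (∑ z : Fin n → F, seqProb ρ z * (if τ < seqProb ρ z then 1 else 0)) +
        (Fintype.card F : ℝ) ^ n * τ := by
  classical
  set T := ∑ z : Fin n → F, seqProb ρ z * (if τ < seqProb ρ z then (1 : ℝ) else 0) with hT
  set P : ℝ := ∏ k, (M k : ℝ) with hP
  have hPpos : 0 < P := Finset.prod_pos fun k _ => by exact_mod_cast hM k
  have hMM : (0 : ℝ) ≤ M k * M l := by positivity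
  have hcw : ∑ w : (k : Fin K) → Fin (M k), (1 : ℝ) = P := by
    simp [hP, Fintype.card_pi]
  set e : ((k : Fin K) → Fin (M k)) → (Fin n → ChannelState F K) → ℝ := fun w H =>
    ∑ z : Fin K → Fin n → F, (∏ k, seqProb ρ (z k)) * (if c.Fails w H z then 1 else 0) with he
  have hH : ∀ H : Fin n → ChannelState F K,
      (M k * M l : ℝ) * ∑ w, (1 - 2 * e w H) ≤
        P * ((M k * M l : ℝ) * T + (Fintype.card F : ℝ) ^ n * τ) := fun H => by
    -- Noise likelier than `τ` is charged to `T`; every other successful noise sequence has weight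
    -- at most `τ`.
    have h2 : ∑ w, (1 - 2 * e w H) ≤ P * T + τ * ∑ w, ∑ z : Fin n → F,
        (if c.JointSuccess k l w H z then (1 : ℝ) else 0) := by
      rw [← hcw, Finset.sum_mul, Finset.mul_sum (s := Finset.univ (α := (k : Fin K) → Fin (M k))),
        ← Finset.sum_add_distrib]
      refine Finset.sum_le_sum fun w _ =>
        (c.one_sub_le_sum_jointSuccess h0 h1 w H k l).trans ?_
      rw [one_mul, hT, Finset.mul_sum, ← Finset.sum_add_distrib]
      refine Finset.sum_le_sum fun z _ => ?_
      have := seqProb_nonneg h0 h1 z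
      split_ifs <;> linarith
    have h3 := mul_le_mul_of_nonneg_left h2 hMM
    have h4 := mul_le_mul_of_nonneg_left (c.sum_jointSuccess_le hkl H) hτ
    linarith
  have hsum := Finset.sum_le_sum fun H (_ : H ∈ Finset.univ) => hH H
  rw [← Finset.mul_sum, Finset.sum_const, Finset.card_univ, nsmul_eq_mul] at hsum
  have hS : (0 : ℝ) < Fintype.card (Fin n → ChannelState F K) := by exact_mod_cast Fintype.card_pos
  have herr : ∑ H : Fin n → ChannelState F K, ∑ w, (1 - 2 * e w H) =
      P * Fintype.card (Fin n → ChannelState F K) * (1 - 2 * c.errorProb ρ) := by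
    have hE : c.errorProb ρ = (∑ H, ∑ w, e w H) /
        (P * Fintype.card (Fin n → ChannelState F K)) := by
      rw [c.errorProb_eq, Finset.sum_comm]
    rw [hE, Finset.sum_comm]
    simp only [Finset.sum_sub_distrib, ← Finset.mul_sum]
    have : ∑ w : (k : Fin K) → Fin (M k), ∑ H : Fin n → ChannelState F K, (1 : ℝ) =
        P * Fintype.card (Fin n → ChannelState F K) := by
      rw [← hcw, Finset.sum_mul]; simp
    rw [this, Finset.sum_comm]
    field_simp
  rw [herr] at hsum
  have : P * Fintype.card (Fin n → ChannelState F K) *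
      ((M k * M l : ℝ) * (1 - 2 * c.errorProb ρ)) ≤ P * Fintype.card (Fin n → ChannelState F K) *
      ((M k * M l : ℝ) * T + (Fintype.card F : ℝ) ^ n * τ) := by linarith
  exact le_of_mul_le_mul_left this (by positivity)

end Converse

/-! ### From the counting bound to the rate bound -/

theorem half_le_floor {x : ℝ} (hx : 1 ≤ x) : x / 2 ≤ (⌊x⌋₊ : ℝ) := by
  have h1 : (1 : ℝ) ≤ ⌊x⌋₊ := by exact_mod_cast Nat.le_floor (by simpa using hx)
  have h2 := Nat.lt_floor_add_one x
  linarith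

theorem one_le_two_rpow {n : ℕ} {r : ℝ} (hr : 0 ≤ r) : (1 : ℝ) ≤ (2 : ℝ) ^ ((n : ℝ) * r) :=
  Real.one_le_rpow one_le_two (by positivity)

theorem pow_eq_two_rpow {q : ℝ} (hq : 0 < q) (n : ℕ) :
    q ^ n = (2 : ℝ) ^ ((n : ℝ) * Real.logb 2 q) := by
  rw [mul_comm, Real.rpow_mul two_pos.le, Real.rpow_logb two_pos (by norm_num) hq,
    Real.rpow_natCast]

variable {F : Type*} [Field F] [Fintype F] [DecidableEq F] {ρ : ℝ} {K : ℕ}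

theorem Achievable.add_le (h0 : 0 ≤ ρ) (h1 : ρ ≤ 1) {R : Fin K → ℝ} (hR : Achievable F K ρ R)
    {k l : Fin K} (hkl : k ≠ l) :
    R k + R l ≤ Real.logb 2 (Fintype.card F : ℝ) - noiseEntropy F ρ := by
  by_contra! hlt
  obtain ⟨γ, hγ⟩ : ∃ γ, γ = R k + R l - (Real.logb 2 (Fintype.card F : ℝ) - noiseEntropy F ρ) :=
    ⟨_, rfl⟩
  have hγ0 : 0 < γ := by linarith
  obtain ⟨r, hr0, hr1, hr⟩ := exists_seqProb_tail_le (F := F) h0 h1 (δ := γ / 4) (by linarith)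
  obtain ⟨N, hN⟩ := hR (min (γ / 8) (1 / 8)) (by positivity)
  obtain ⟨N₁, hN₁⟩ := ((tendsto_pow_atTop_nhds_zero_of_lt_one hr0 hr1).eventually
    (gt_mem_nhds (show (0 : ℝ) < 1 / 4 by norm_num))).exists_forall_of_atTop
  -- Of the excess `γ`, the rate slack and the noise tail use `γ / 4` each. The remaining `n * γ /
  -- 2` must exceed the exponent 3 of the constant 8 = 4 · 2, which stems from two floors and from a
  -- success weight of at least 1/2.
  obtain ⟨N₂, hN₂⟩ := exists_nat_gt (6 / γ)
  obtain ⟨n, hn⟩ : ∃ n, n = max N (max N₁ N₂) := ⟨_, rfl⟩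
  obtain ⟨R', hR', c, hc⟩ := hN n (by rw [hn]; exact le_max_left _ _)
  have hrn := hN₁ n (by rw [hn]; exact (le_max_left _ _).trans (le_max_right _ _))
  have hn2 : (N₂ : ℝ) ≤ n := by
    rw [hn]; exact_mod_cast (le_max_right N₁ N₂).trans (le_max_right _ _)
  have hε8 := min_le_left (γ / 8) (1 / 8)
  have hε1 := min_le_right (γ / 8) (1 / 8)
  have hM : ∀ k, 0 < ⌊(2 : ℝ) ^ ((n : ℝ) * R' k)⌋₊ := fun k =>
    Nat.floor_pos.2 (one_le_two_rpow (hR' k).1)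
  have hb := c.converse_bound h0 h1 hM hkl
    (τ := (2 : ℝ) ^ (n * (-noiseEntropy F ρ + γ / 4))) (by positivity)
  have hq : (0 : ℝ) < Fintype.card F := zero_lt_one.trans one_lt_card_real
  have htail := hr n
  rw [pow_eq_two_rpow hq, ← Real.rpow_add two_pos] at hb
  have hk2 := half_le_floor (one_le_two_rpow (n := n) (hR' k).1)
  have hl2 := half_le_floor (one_le_two_rpow (n := n) (hR' l).1)
  have hMM : (2 : ℝ) ^ ((n : ℝ) * R' k + n * R' l) / 4 ≤
      (⌊(2 : ℝ) ^ ((n : ℝ) * R' k)⌋₊ * ⌊(2 : ℝ) ^ ((n : ℝ) * R' l)⌋₊ : ℝ) := by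
    refine le_trans (le_of_eq ?_) (mul_le_mul hk2 hl2 (by positivity) (by positivity))
    rw [Real.rpow_add two_pos]; ring
  set m : ℝ := (⌊(2 : ℝ) ^ ((n : ℝ) * R' k)⌋₊ * ⌊(2 : ℝ) ^ ((n : ℝ) * R' l)⌋₊ : ℝ) with hm
  have hm0 : 0 ≤ m := by positivity
  have h5 : m * (1 / 2) ≤ m * (1 - 2 * c.errorProb ρ - r ^ n) :=
    mul_le_mul_of_nonneg_left (by linarith) hm0
  have h6 := mul_le_mul_of_nonneg_left htail hm0
  have h7 : (2 : ℝ) ^ ((n : ℝ) * R' k + n * R' l) / 8 ≤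
      2 ^ (n * Real.logb 2 (Fintype.card F : ℝ) + n * (-noiseEntropy F ρ + γ / 4)) := by
    linarith
  have h8 : (2 : ℝ) ^ ((n : ℝ) * R' k + n * R' l) ≤
      2 ^ (3 + (n * Real.logb 2 (Fintype.card F : ℝ) + n * (-noiseEntropy F ρ + γ / 4))) := by
    rw [Real.rpow_add two_pos 3]
    norm_num at h7 ⊢
    linarith
  rw [Real.rpow_le_rpow_left_iff one_lt_two] at h8
  have hn6 : 6 < n * γ := by
    have := (div_lt_iff₀ hγ0).1 (hN₂.trans_le hn2)
    linarith
  have h9 : (n : ℝ) * (R k + R l - γ / 4) ≤ n * (R' k + R' l) :=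
    mul_le_mul_of_nonneg_left (by linarith [(hR' k).2, (hR' l).2]) (Nat.cast_nonneg n)
  have h10 : R k + R l = γ + (Real.logb 2 (Fintype.card F : ℝ) - noiseEntropy F ρ) := by
    linarith
  rw [h10] at h9
  linarith

/-- The message vectors of one transmitter: stream `o` of channel state `S` carries `d o` symbols. -/
abbrev Streams (F : Type*) [Field F] (K : ℕ) {O : Type*} (d : O → ℕ) : Type _ :=
  (o : O) → ChannelState F K → Fin (d o) → F

/-! ### Linear codes and the likelihood test -/

section Definitions

variable {F : Type*} [Field F] [Fintype F] [DecidableEq F] {K n : ℕ} {M : Fin K → ℕ}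
  {P O : Type*} [DecidableEq P] {d : O → ℕ} (o : P → O)
  (ψ : P → ChannelState F K → ChannelState F K)

/-- The linear combination of message vectors that receiver `k` observes, in phase `p` and channel
state `S`, when stream `o p` of state `ψ p S` is transmitted. -/
def combination (k : Fin K) (v : Fin K → Streams F K d) (p : P) (S : ChannelState F K) :
    Fin (d (o p)) → F :=
  ∑ l, (S k l : F) • v l (o p) (ψ p S)

/-- The normalized likelihood of the noise during phase `p` and channel state `S`. -/
def noiseLikelihood (ρ : ℝ) (x : Fin n → P) (H : Fin n → ChannelState F K) (z : Fin n → F) (p : P)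
    (S : ChannelState F K) : ℝ :=
  ∏ t, if x t = p ∧ H t = S then (Fintype.card F : ℝ) * noiseProb ρ (z t) else 1

/-- The normalized likelihood of the linear combination `u` in phase `p` and channel state `S`,
given the outputs `y`. -/
def likelihood (ρ : ℝ) (x : Fin n → P) (g : Fin n → (i : O) → Fin (d i) → F)
    (H : Fin n → ChannelState F K) (y : Fin n → F) (p : P) (S : ChannelState F K)
    (u : Fin (d (o p)) → F) : ℝ :=
  noiseLikelihood ρ x H (fun t => y t - g t (o p) ⬝ᵥ u) p S

/-- The messages `w` pass the likelihood test of receiver `k`. -/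
def Passes (ρ : ℝ) (θ : P → ℝ) (x : Fin n → P) (g : Fin n → (i : O) → Fin (d i) → F)
    (e : (l : Fin K) → Fin (M l) → Streams F K d) (k : Fin K) (H : Fin n → ChannelState F K)
    (y : Fin n → F) (w : (l : Fin K) → Fin (M l)) : Prop :=
  ∀ p S, θ p ≤ likelihood o ρ x g H y p S (combination o ψ k (fun l => e l (w l)) p S)

open Classical in
/-- The linear code with phases `x` and generator vectors `g`, for the message vectors `e`. The
receivers apply a likelihood test with thresholds `θ` to the linear combinations they observe. -/
def linearCode (ρ : ℝ) (θ : P → ℝ) (x : Fin n → P) (g : Fin n → (i : O) → Fin (d i) → F)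
    (e : (l : Fin K) → Fin (M l) → Streams F K d) (hM : ∀ l, 0 < M l) : Code F K n M where
  enc l m H t := g t (o (x t)) ⬝ᵥ e l m (o (x t)) (ψ (x t) (H t))
  causal l m H H' t h := by rw [h t le_rfl]
  -- Any tuple passing every test is accepted, and only its entry `k` is used; the other entries may
  -- be wrong. Message 0 is a default.
  dec k H y := if h : ∃ w, Passes o ψ ρ θ x g e k H y w then h.choose k else ⟨0, hM k⟩

end Definitions

/-! ### Failure events of a linear code -/

section Decoding

variable {F : Type*} [Field F] [Fintype F] [DecidableEq F] {K n : ℕ} {M : Fin K → ℕ} {ρ : ℝ}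
  {P O : Type*} [DecidableEq P] {d : O → ℕ} {o : P → O}
  {ψ : P → ChannelState F K → ChannelState F K} {θ : P → ℝ} {x : Fin n → P}
  {g : Fin n → (i : O) → Fin (d i) → F} {e : (l : Fin K) → Fin (M l) → Streams F K d}
  {hM : ∀ l, 0 < M l}

theorem noiseLikelihood_nonneg (h0 : 0 ≤ ρ) (h1 : ρ ≤ 1) (x : Fin n → P)
    (H : Fin n → ChannelState F K) (z : Fin n → F) (p : P) (S : ChannelState F K) :
    0 ≤ noiseLikelihood ρ x H z p S := by
  refine Finset.prod_nonneg fun t _ => ?_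
  split_ifs
  · exact mul_nonneg (Nat.cast_nonneg _) (noiseProb_nonneg h0 h1 _)
  · exact zero_le_one

theorem channelOutput_linearCode (w : (l : Fin K) → Fin (M l)) (H : Fin n → ChannelState F K)
    (z : Fin K → Fin n → F) (k : Fin K) (t : Fin n) :
    channelOutput H (fun l => (linearCode o ψ ρ θ x g e hM).enc l (w l) H) z k t =
      g t (o (x t)) ⬝ᵥ combination o ψ k (fun l => e l (w l)) (x t) (H t) + z k t := by
  simp [channelOutput, linearCode, combination, dotProduct_sum, dotProduct_smul]

/-- Only slots in phase `p` and state `S` count, and there the output contains exactly the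
combination being tested. The error in a candidate thus acts as additional noise. -/
theorem likelihood_linearCode (w : (l : Fin K) → Fin (M l)) (H : Fin n → ChannelState F K)
    (z : Fin K → Fin n → F) (k : Fin K) (p : P) (S : ChannelState F K) (u : Fin (d (o p)) → F) :
    likelihood o ρ x g H
        (channelOutput H (fun l => (linearCode o ψ ρ θ x g e hM).enc l (w l) H) z k) p S u =
      noiseLikelihood ρ x H (fun t => z k t +
        g t (o p) ⬝ᵥ (combination o ψ k (fun l => e l (w l)) p S - u)) p S := by
  unfold likelihood noiseLikelihood
  refine Finset.prod_congr rfl fun t _ => ?_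
  split_ifs with h
  · obtain ⟨rfl, rfl⟩ := h
    simp only [channelOutput_linearCode, dotProduct_sub]
    congr 2
    ring
  · rfl

open Classical in
/-- A linear code fails only if some receiver sees unlikely noise or a likely false combination. -/
theorem fails_linearCode_le [Fintype P] (h0 : 0 ≤ ρ) (h1 : ρ ≤ 1) (hθ : ∀ p, 0 < θ p)
    (he : ∀ k (w w' : (l : Fin K) → Fin (M l)), (∀ p S,
      combination o ψ k (fun l => e l (w l)) p S = combination o ψ k (fun l => e l (w' l)) p S) →
      w k = w' k)
    (w : (l : Fin K) → Fin (M l)) (H : Fin n → ChannelState F K) (z : Fin K → Fin n → F) :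
    (if (linearCode o ψ ρ θ x g e hM).Fails w H z then (1 : ℝ) else 0) ≤
      ∑ k, ∑ p, ∑ S, ((if noiseLikelihood ρ x H (z k) p S < θ p then 1 else 0) +
        ∑ v ∈ Finset.univ.erase (0 : Fin (d (o p)) → F),
          noiseLikelihood ρ x H (fun t => z k t + g t (o p) ⬝ᵥ v) p S / θ p) := by
  have hterm : ∀ k p S, 0 ≤ (if noiseLikelihood ρ x H (z k) p S < θ p then (1 : ℝ) else 0) +
        ∑ v ∈ Finset.univ.erase (0 : Fin (d (o p)) → F),
          noiseLikelihood ρ x H (fun t => z k t + g t (o p) ⬝ᵥ v) p S / θ p := fun k p S =>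
    add_nonneg (by split_ifs <;> norm_num) (Finset.sum_nonneg fun v _ =>
      div_nonneg (noiseLikelihood_nonneg h0 h1 _ _ _ _ _) (hθ p).le)
  split_ifs with hf
  swap
  · exact Finset.sum_nonneg fun k _ => Finset.sum_nonneg fun p _ => Finset.sum_nonneg fun S _ =>
      hterm k p S
  obtain ⟨k, hk⟩ := hf
  suffices h : ∃ p S, 1 ≤ (if noiseLikelihood ρ x H (z k) p S < θ p then (1 : ℝ) else 0) +
        ∑ v ∈ Finset.univ.erase (0 : Fin (d (o p)) → F),
          noiseLikelihood ρ x H (fun t => z k t + g t (o p) ⬝ᵥ v) p S / θ p by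
    obtain ⟨p, S, h⟩ := h
    refine h.trans ?_
    refine (Finset.single_le_sum (f := fun S => _) (fun S _ => hterm k p S)
      (Finset.mem_univ S)).trans ?_
    refine (Finset.single_le_sum (f := fun p => _) (fun p _ => Finset.sum_nonneg fun S _ =>
      hterm k p S) (Finset.mem_univ p)).trans ?_
    exact Finset.single_le_sum (f := fun k => _) (fun k _ => Finset.sum_nonneg fun p _ =>
      Finset.sum_nonneg fun S _ => hterm k p S) (Finset.mem_univ k)
  by_contra! hsmall
  have hgood : ∀ p S, θ p ≤ noiseLikelihood ρ x H (z k) p S := fun p S => by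
    by_contra! hlt
    have hn : 0 ≤ ∑ v ∈ Finset.univ.erase (0 : Fin (d (o p)) → F),
        noiseLikelihood ρ x H (fun t => z k t + g t (o p) ⬝ᵥ v) p S / θ p :=
      Finset.sum_nonneg fun v _ => div_nonneg (noiseLikelihood_nonneg h0 h1 _ _ _ _ _) (hθ p).le
    have := hsmall p S
    rw [if_pos hlt] at this
    linarith
  -- A false combination reaching the threshold would by itself contribute a term of at least 1.
  have hbad : ∀ p S (v : Fin (d (o p)) → F), v ≠ 0 →
      noiseLikelihood ρ x H (fun t => z k t + g t (o p) ⬝ᵥ v) p S < θ p := fun p S v hv => by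
    by_contra! hle
    have hn := Finset.single_le_sum (f := fun v : Fin (d (o p)) → F =>
      noiseLikelihood ρ x H (fun t => z k t + g t (o p) ⬝ᵥ v) p S / θ p)
      (fun v _ => div_nonneg (noiseLikelihood_nonneg h0 h1 _ _ _ _ _) (hθ p).le)
      (Finset.mem_erase.2 ⟨hv, Finset.mem_univ v⟩)
    have h1' := (one_le_div (hθ p)).2 hle
    have := hsmall p S
    rw [if_neg (hgood p S).not_gt] at this
    linarith
  refine hk ?_
  set y := channelOutput H (fun l => (linearCode o ψ ρ θ x g e hM).enc l (w l) H) z k with hy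
  have hpass : ∃ w, Passes o ψ ρ θ x g e k H y w := ⟨w, fun p S => by
    rw [hy, likelihood_linearCode]
    simpa using hgood p S⟩
  have hdec : (linearCode o ψ ρ θ x g e hM).dec k H y = hpass.choose k := dif_pos hpass
  rw [hdec]
  -- The accepted tuple may differ from the true one, but it must yield the same combinations, since
  -- a false combination fails its test.
  refine he k _ _ fun p S => ?_
  by_contra hne
  have h1' := (hpass.choose_spec p S).trans_eq (likelihood_linearCode w H z k p S _)
  exact absurd h1' (hbad p S _ (sub_ne_zero.2 (Ne.symm hne))).not_ge

end Decoding

/-! ### Averages over random generators -/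

section Averages

variable {F : Type*} [Field F] [Fintype F] [DecidableEq F] {K n : ℕ} {ρ : ℝ}
  {P O : Type*} [DecidableEq P] [Fintype O] [DecidableEq O] {d : O → ℕ}

omit [DecidableEq F] in
/-- A nonzero linear functional of a uniform vector is uniform. -/
theorem card_mul_sum_comp_dotProduct (i : O) {v : Fin (d i) → F} (hv : v ≠ 0) (f : F → ℝ) :
    (Fintype.card F : ℝ) * ∑ a : (i : O) → Fin (d i) → F, f (a i ⬝ᵥ v) =
      Fintype.card ((i : O) → Fin (d i) → F) * ∑ x, f x := by
  obtain ⟨j, hj⟩ := Function.ne_iff.1 hv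
  have hj' : v j ≠ 0 := hj
  -- Translating the generators by `b x` shifts the functional by `x`, so all its values are
  -- equidistributed.
  let b : F → (i : O) → Fin (d i) → F := fun x => Pi.single i (Pi.single j (x / v j))
  have hb : ∀ x a, (a + b x) i ⬝ᵥ v = a i ⬝ᵥ v + x := fun x a => by
    simp [b, add_dotProduct, single_dotProduct, hj']
  have h1 : ∀ x, ∑ a : (i : O) → Fin (d i) → F, f (a i ⬝ᵥ v) =
      ∑ a : (i : O) → Fin (d i) → F, f (a i ⬝ᵥ v + x) := fun x => by
    rw [← Equiv.sum_comp (Equiv.addRight (b x))]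
    simp only [Equiv.coe_addRight, hb]
  have h2 : ∑ _x : F, ∑ a : (i : O) → Fin (d i) → F, f (a i ⬝ᵥ v) =
      ∑ a : (i : O) → Fin (d i) → F, ∑ x, f x := by
    rw [Finset.sum_congr rfl fun x _ => h1 x, Finset.sum_comm]
    exact Finset.sum_congr rfl fun a _ => Equiv.sum_comp (Equiv.addLeft (a i ⬝ᵥ v)) f
  simpa using h2

/-- Slots are independent, and in a counted slot the shifted noise is uniform, so the factor
averages to 1. Hence a false combination has mean likelihood 1 whatever the noise, and passes
threshold θ with probability at most 1/θ. -/
theorem sum_noiseLikelihood_add_dotProduct (x : Fin n → P) (H : Fin n → ChannelState F K)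
    (z : Fin n → F) (p : P) (S : ChannelState F K) (i : O) {v : Fin (d i) → F} (hv : v ≠ 0) :
    ∑ g : Fin n → (i : O) → Fin (d i) → F,
      noiseLikelihood ρ x H (fun t => z t + g t i ⬝ᵥ v) p S =
      (Fintype.card ((i : O) → Fin (d i) → F) : ℝ) ^ n := by
  have h := Fintype.prod_sum (fun (t : Fin n) (a : (i : O) → Fin (d i) → F) =>
    if x t = p ∧ H t = S then (Fintype.card F : ℝ) * noiseProb ρ (z t + a i ⬝ᵥ v) else 1)
  unfold noiseLikelihood
  rw [← h]
  refine (Finset.prod_congr rfl fun t _ => ?_).trans (Fin.prod_const n _)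
  by_cases hc : x t = p ∧ H t = S
  · have h1 : ∑ y, noiseProb ρ (z t + y) = 1 :=
      (Equiv.sum_comp (Equiv.addLeft (z t)) (noiseProb ρ)).trans (sum_noiseProb ρ)
    simp only [if_pos hc]
    rw [← Finset.mul_sum, card_mul_sum_comp_dotProduct i hv fun y => noiseProb ρ (z t + y),
      h1, mul_one]
  · simp [if_neg hc]

end Averages

/-! ### The likelihood of the true combination -/

section LikelihoodTail

variable {F : Type*} [Field F] [Fintype F] [DecidableEq F] {ρ : ℝ}

theorem sum_noiseProb_mul_logb (ρ : ℝ) :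
    ∑ z : F, noiseProb ρ z * Real.logb 2 ((Fintype.card F : ℝ) * noiseProb ρ z) =
      Real.logb 2 (Fintype.card F : ℝ) - noiseEntropy F ρ := by
  have hq : (Fintype.card F : ℝ) ≠ 0 := (zero_lt_one.trans one_lt_card_real).ne'
  have h : ∀ z : F, noiseProb ρ z * Real.logb 2 ((Fintype.card F : ℝ) * noiseProb ρ z) =
      noiseProb ρ z * Real.logb 2 (Fintype.card F : ℝ) +
        noiseProb ρ z * Real.logb 2 (noiseProb ρ z) := fun z => by
    by_cases hz : noiseProb ρ z = 0
    · simp [hz]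
    · rw [Real.logb_mul hq hz, mul_add]
  simp only [h, Finset.sum_add_distrib, ← Finset.sum_mul, sum_noiseProb, noiseEntropy]
  ring

/-- The true linear combination is likely, on average over phases, channel states and noise. -/
theorem exists_noiseLikelihood_tail_le {P : Type*} [Fintype P] [DecidableEq P] (h0 : 0 ≤ ρ)
    (h1 : ρ ≤ 1) (K : ℕ) {π : P → ℝ} (hπ : ∀ p, 0 ≤ π p) (hπ1 : ∑ p, π p = 1) {δ : ℝ}
    (hδ : 0 < δ) (p : P) (S : ChannelState F K) :
    ∃ r : ℝ, 0 ≤ r ∧ r < 1 ∧ ∀ n : ℕ,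
      ∑ x : Fin n → P, ∑ H : Fin n → ChannelState F K, ∑ z : Fin n → F,
        (∏ t, π (x t)) * ((Fintype.card (ChannelState F K) : ℝ)⁻¹ ^ n * (seqProb ρ z *
          if noiseLikelihood ρ x H z p S < (2 : ℝ) ^ ((n : ℝ) *
            (π p / Fintype.card (ChannelState F K) *
              (Real.logb 2 (Fintype.card F : ℝ) - noiseEntropy F ρ) - δ)) then 1 else 0))
        ≤ r ^ n := by
  set s := (Fintype.card (ChannelState F K) : ℝ) with hs
  set C := Real.logb 2 (Fintype.card F : ℝ) - noiseEntropy F ρ with hC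
  have hs0 : 0 < s := by rw [hs]; exact_mod_cast Fintype.card_pos
  have hq : 0 < (Fintype.card F : ℝ) := zero_lt_one.trans one_lt_card_real
  -- Phase, state and noise form one i.i.d. letter, and `f` vanishes off `(p, S)`. A single Chernoff
  -- bound then covers both the noise and the random number of useful slots.
  let wt : P × ChannelState F K × F → ℝ := fun a => π a.1 * (s⁻¹ * noiseProb ρ a.2.2)
  let f : P × ChannelState F K × F → ℝ := fun a =>
    if a.1 = p ∧ a.2.1 = S then -Real.logb 2 ((Fintype.card F : ℝ) * noiseProb ρ a.2.2) else 0
  have hwt : ∀ a, 0 ≤ wt a := fun a =>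
    mul_nonneg (hπ _) (mul_nonneg (inv_nonneg.2 hs0.le) (noiseProb_nonneg h0 h1 _))
  have hwt1 : ∑ a, wt a = 1 := by
    simp only [wt, Fintype.sum_prod_type, ← Finset.mul_sum, sum_noiseProb, mul_one,
      Finset.sum_const, Finset.card_univ, nsmul_eq_mul]
    rw [← hπ1]
    refine Finset.sum_congr rfl fun p _ => ?_
    rw [← hs]
    field_simp
  have hmean : ∑ a, wt a * f a = -(π p / s * C) := by
    have : ∀ (p' : P) (S' : ChannelState F K) (z : F), wt (p', S', z) * f (p', S', z) =
        if p' = p then (if S' = S then -(π p / s) *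
          (noiseProb ρ z * Real.logb 2 ((Fintype.card F : ℝ) * noiseProb ρ z)) else 0) else 0 := by
      intro p' S' z
      by_cases hp : p' = p
      · by_cases hS : S' = S
        · simp only [wt, f, hp, hS, and_self, if_true]
          ring
        · simp [f, hS]
      · simp [f, hp]
    simp only [Fintype.sum_prod_type, this]
    rw [Finset.sum_eq_single p (by intro b _ hb; simp [hb]) (by simp),
      Finset.sum_eq_single S (by intro b _ hb; simp [hb]) (by simp)]
    simp only [if_true, ← Finset.mul_sum, sum_noiseProb_mul_logb]
    rw [← hC]; ring
  obtain ⟨r, hr0, hr1, hr⟩ := exists_tail_le_pow wt f hwt hwt1 (m := -(π p / s * C - δ))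
    (by rw [hmean]; linarith)
  refine ⟨r, hr0, hr1, fun n => le_trans ?_ (hr n)⟩
  let E : (Fin n → P × ChannelState F K × F) ≃
      (Fin n → P) × (Fin n → ChannelState F K) × (Fin n → F) :=
    (Equiv.arrowProdEquivProdArrow _ _ _).trans
      ((Equiv.refl _).prodCongr (Equiv.arrowProdEquivProdArrow _ _ _))
  have hsum : ∀ φ : (Fin n → P) → (Fin n → ChannelState F K) → (Fin n → F) → ℝ,
      ∑ x, ∑ H, ∑ z, φ x H z = ∑ a : Fin n → P × ChannelState F K × F,
        φ (fun t => (a t).1) (fun t => (a t).2.1) (fun t => (a t).2.2) := fun φ => by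
    rw [Fintype.sum_equiv E (fun a => φ (fun t => (a t).1) (fun t => (a t).2.1)
      (fun t => (a t).2.2)) (fun b => φ b.1 b.2.1 b.2.2) fun a => rfl]
    simp only [Fintype.sum_prod_type]
  rw [hsum]
  refine Finset.sum_le_sum fun a _ => ?_
  have hw : ∏ t, wt (a t) = (∏ t, π (a t).1) * (s⁻¹ ^ n * seqProb ρ fun t => (a t).2.2) := by
    simp only [wt, Finset.prod_mul_distrib, seqProb]
    simp
  rw [← mul_assoc (s⁻¹ ^ n), ← mul_assoc, ← hw]
  -- Letters of weight zero are set aside because the likelihood may vanish there, and its logarithm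
  -- would be meaningless.
  by_cases hz : ∏ t, wt (a t) = 0
  · rw [hz, zero_mul, zero_mul]
  have hz' : ∀ t, noiseProb ρ (a t).2.2 ≠ 0 := fun t h =>
    Finset.prod_ne_zero_iff.1 hz t (Finset.mem_univ t) (by simp [wt, h])
  have hfac : ∀ t, (if (a t).1 = p ∧ (a t).2.1 = S then
      (Fintype.card F : ℝ) * noiseProb ρ (a t).2.2 else 1) ≠ 0 := fun t => by
    split_ifs
    · exact mul_ne_zero hq.ne' (hz' t)
    · exact one_ne_zero
  have hN : noiseLikelihood ρ (fun t => (a t).1) (fun t => (a t).2.1) (fun t => (a t).2.2) p S =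
      (2 : ℝ) ^ (-∑ t, f (a t)) := by
    have hpos : 0 < noiseLikelihood ρ (fun t => (a t).1) (fun t => (a t).2.1)
        (fun t => (a t).2.2) p S :=
      (noiseLikelihood_nonneg h0 h1 _ _ _ _ _).lt_of_ne
        (Finset.prod_ne_zero_iff.2 fun t _ => hfac t).symm
    rw [← Real.rpow_logb two_pos (by norm_num) hpos, noiseLikelihood,
      Real.logb_prod _ _ fun t _ => hfac t, ← Finset.sum_neg_distrib]
    congr 1
    refine Finset.sum_congr rfl fun t _ => ?_
    simp only [f]
    split_ifs <;> simp
  refine mul_le_mul_of_nonneg_left ?_ (Finset.prod_nonneg fun t _ => hwt _)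
  simp only [hN, Real.rpow_lt_rpow_left_iff one_lt_two]
  split_ifs with h h' h'
  · exact le_rfl
  · exact absurd (by linarith) h'
  · exact zero_le_one
  · exact le_rfl

end LikelihoodTail

theorem exists_le_of_weighted_sum_le {ι : Type*} [Fintype ι] {W a : ι → ℝ} {B : ℝ}
    (hW : ∀ i, 0 ≤ W i) (hW1 : ∑ i, W i = 1) (h : ∑ i, W i * a i ≤ B) : ∃ i, a i ≤ B := by
  by_contra! hlt
  obtain ⟨i, -, hi⟩ := Finset.exists_ne_zero_of_sum_ne_zero
    (show ∑ i, W i ≠ 0 by rw [hW1]; exact one_ne_zero)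
  have : ∑ i, W i * B < ∑ i, W i * a i :=
    Finset.sum_lt_sum (fun i _ => mul_le_mul_of_nonneg_left (hlt i).le (hW i))
      ⟨i, Finset.mem_univ i, mul_lt_mul_of_pos_left (hlt i) ((hW i).lt_of_ne hi.symm)⟩
  rw [← Finset.sum_mul, hW1, one_mul] at this
  linarith

/-! ### Random coding and derandomization -/

section RandomCoding

variable {F : Type*} [Field F] [Fintype F] [DecidableEq F] {K n : ℕ} {M : Fin K → ℕ} {ρ : ℝ}
  {P O : Type*} [Fintype P] [DecidableEq P] [Fintype O] [DecidableEq O] {d : O → ℕ} {o : P → O}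
  {ψ : P → ChannelState F K → ChannelState F K} {θ : P → ℝ}
  {e : (l : Fin K) → Fin (M l) → Streams F K d}

open Classical in
/-- The failure probability for fixed messages and phases, averaged over the generator vectors. -/
theorem sum_generators_fails_le (h0 : 0 ≤ ρ) (h1 : ρ ≤ 1) (hθ : ∀ p, 0 < θ p)
    (hM : ∀ l, 0 < M l)
    (he : ∀ k (w w' : (l : Fin K) → Fin (M l)), (∀ p S,
      combination o ψ k (fun l => e l (w l)) p S = combination o ψ k (fun l => e l (w' l)) p S) →
      w k = w' k)
    (x : Fin n → P) (w : (l : Fin K) → Fin (M l)) (H : Fin n → ChannelState F K) :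
    ∑ g : Fin n → (i : O) → Fin (d i) → F, ∑ z : Fin K → Fin n → F, (∏ k, seqProb ρ (z k)) *
        (if (linearCode o ψ ρ θ x g e hM).Fails w H z then 1 else 0) ≤
      (Fintype.card ((i : O) → Fin (d i) → F) : ℝ) ^ n * (K * ∑ p, ∑ S,
        (∑ z : Fin n → F, seqProb ρ z * (if noiseLikelihood ρ x H z p S < θ p then 1 else 0) +
          ((Fintype.card F : ℝ) ^ d (o p) - 1) / θ p)) := by
  set G := (Fintype.card ((i : O) → Fin (d i) → F) : ℝ) with hG
  -- The bound for one receiver depends only on its own noise, so marginalization leaves `K` equal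
  -- terms.
  let φ : (Fin n → F) → ℝ := fun z => ∑ p, ∑ S,
    ((if noiseLikelihood ρ x H z p S < θ p then 1 else 0) +
      ((Fintype.card F : ℝ) ^ d (o p) - 1) / θ p)
  have hcg : ∑ _g : Fin n → (i : O) → Fin (d i) → F, (1 : ℝ) = G ^ n := by
    rw [hG]; simp
  have hz : ∀ z : Fin K → Fin n → F, ∑ g : Fin n → (i : O) → Fin (d i) → F,
      (if (linearCode o ψ ρ θ x g e hM).Fails w H z then (1 : ℝ) else 0) ≤
      ∑ k, G ^ n * φ (z k) := fun z => by
    refine (Finset.sum_le_sum fun g _ => fails_linearCode_le h0 h1 hθ he w H z).trans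
      (le_of_eq ?_)
    rw [Finset.sum_comm]
    refine Finset.sum_congr rfl fun k _ => ?_
    rw [Finset.sum_comm, Finset.mul_sum]
    refine Finset.sum_congr rfl fun p _ => ?_
    rw [Finset.sum_comm, Finset.mul_sum]
    refine Finset.sum_congr rfl fun S _ => ?_
    rw [Finset.sum_add_distrib, mul_add, ← hcg, Finset.sum_mul, Finset.sum_mul]
    simp only [one_mul]
    congr 1
    rw [Finset.sum_comm, Finset.sum_congr rfl fun v hv => by
      rw [← Finset.sum_div, sum_noiseLikelihood_add_dotProduct x H (z k) p S (o p)
        (Finset.ne_of_mem_erase hv)]]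
    rw [Finset.sum_const, Finset.card_erase_of_mem (Finset.mem_univ _), Finset.card_univ,
      nsmul_eq_mul, Nat.cast_sub Fintype.card_pos, Finset.sum_const, Finset.card_univ,
      nsmul_eq_mul, Fintype.card_fun, Fintype.card_fun, Fintype.card_fin, Fintype.card_fin]
    push_cast
    ring
  have hφ : ∑ z : Fin n → F, seqProb ρ z * φ z = ∑ p, ∑ S,
      (∑ z : Fin n → F, seqProb ρ z * (if noiseLikelihood ρ x H z p S < θ p then 1 else 0) +
          ((Fintype.card F : ℝ) ^ d (o p) - 1) / θ p) := by
    simp only [φ, Finset.mul_sum]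
    rw [Finset.sum_comm]
    refine Finset.sum_congr rfl fun p _ => ?_
    rw [Finset.sum_comm]
    refine Finset.sum_congr rfl fun S _ => ?_
    simp only [mul_add, Finset.sum_add_distrib, ← Finset.sum_mul, sum_seqProb, one_mul]
  rw [Finset.sum_comm, ← hφ]
  calc _ ≤ ∑ z : Fin K → Fin n → F, (∏ k, seqProb ρ (z k)) * ∑ k, G ^ n * φ (z k) := by
        refine Finset.sum_le_sum fun z _ => ?_
        rw [← Finset.mul_sum]
        exact mul_le_mul_of_nonneg_left (hz z)
          (Finset.prod_nonneg fun k _ => seqProb_nonneg h0 h1 _)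
    _ = ∑ k : Fin K, ∑ z : Fin K → Fin n → F, (∏ k, seqProb ρ (z k)) * (G ^ n * φ (z k)) := by
        simp only [Finset.mul_sum]
        rw [Finset.sum_comm]
    _ = _ := by
        simp only [sum_prod_mul_eval (seqProb ρ) (sum_seqProb ρ n) _ fun z => G ^ n * φ z]
        rw [Finset.sum_const, Finset.card_univ, Fintype.card_fin, nsmul_eq_mul]
        simp only [mul_left_comm _ (G ^ n), ← Finset.mul_sum]

/-- The error probability for fixed phases, averaged over the generator vectors. -/
theorem sum_errorProb_linearCode_le (h0 : 0 ≤ ρ) (h1 : ρ ≤ 1) (hθ : ∀ p, 0 < θ p)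
    (hM : ∀ l, 0 < M l)
    (he : ∀ k (w w' : (l : Fin K) → Fin (M l)), (∀ p S,
      combination o ψ k (fun l => e l (w l)) p S = combination o ψ k (fun l => e l (w' l)) p S) →
      w k = w' k)
    (x : Fin n → P) :
    ∑ g : Fin n → (i : O) → Fin (d i) → F, (linearCode o ψ ρ θ x g e hM).errorProb ρ ≤
      (Fintype.card ((i : O) → Fin (d i) → F) : ℝ) ^ n * (K * ∑ p, ∑ S : ChannelState F K,
        (∑ H : Fin n → ChannelState F K, ∑ z : Fin n → F,
          (Fintype.card (ChannelState F K) : ℝ)⁻¹ ^ n *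
            (seqProb ρ z * (if noiseLikelihood ρ x H z p S < θ p then 1 else 0)) +
          ((Fintype.card F : ℝ) ^ d (o p) - 1) / θ p)) := by
  classical
  set s := (Fintype.card (ChannelState F K) : ℝ) with hs
  set G := (Fintype.card ((i : O) → Fin (d i) → F) : ℝ) with hG
  have hs0 : 0 < s := by rw [hs]; exact_mod_cast Fintype.card_pos
  have hsn : (Fintype.card (Fin n → ChannelState F K) : ℝ) = s ^ n := by
    rw [hs]; simp [Fintype.card_pi]
  have hPM : 0 < ∏ k, (M k : ℝ) := Finset.prod_pos fun k _ => by exact_mod_cast hM k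
  have hcw : ∑ _w : (k : Fin K) → Fin (M k), (1 : ℝ) = ∏ k, (M k : ℝ) := by
    simp [Fintype.card_pi]
  simp only [Code.errorProb_eq]
  rw [← Finset.sum_div, div_le_iff₀ (by rw [hsn]; positivity), Finset.sum_comm, hsn, ← hcw,
    Finset.sum_mul, Finset.mul_sum]
  refine Finset.sum_le_sum fun w _ => ?_
  rw [Finset.sum_comm]
  refine (Finset.sum_le_sum fun H _ =>
    sum_generators_fails_le h0 h1 hθ hM he x w H).trans (le_of_eq ?_)
  rw [← Finset.mul_sum, ← Finset.mul_sum, one_mul, mul_assoc, mul_assoc]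
  congr 2
  rw [Finset.sum_comm, Finset.sum_mul]
  refine Finset.sum_congr rfl fun p _ => ?_
  rw [Finset.sum_comm, Finset.sum_mul]
  refine Finset.sum_congr rfl fun S _ => ?_
  rw [Finset.sum_add_distrib, add_mul]
  congr 1
  · simp only [← Finset.mul_sum]
    rw [mul_right_comm, ← mul_pow, inv_mul_cancel₀ hs0.ne', one_pow, one_mul]
  · rw [Finset.sum_const, Finset.card_univ, nsmul_eq_mul, hsn, mul_comm]

/-- Random coding: some choice of phases and generator vectors is as good as the average. -/
theorem exists_errorProb_linearCode_le (h0 : 0 ≤ ρ) (h1 : ρ ≤ 1) (hθ : ∀ p, 0 < θ p)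
    (hM : ∀ l, 0 < M l)
    (he : ∀ k (w w' : (l : Fin K) → Fin (M l)), (∀ p S,
      combination o ψ k (fun l => e l (w l)) p S = combination o ψ k (fun l => e l (w' l)) p S) →
      w k = w' k)
    {π : P → ℝ} (hπ : ∀ p, 0 ≤ π p) (hπ1 : ∑ p, π p = 1) :
    ∃ (x : Fin n → P) (g : Fin n → (i : O) → Fin (d i) → F),
      (linearCode o ψ ρ θ x g e hM).errorProb ρ ≤ K * ∑ p, ∑ S : ChannelState F K,
        (∑ x : Fin n → P, ∑ H : Fin n → ChannelState F K, ∑ z : Fin n → F, (∏ t, π (x t)) *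
          ((Fintype.card (ChannelState F K) : ℝ)⁻¹ ^ n *
            (seqProb ρ z * (if noiseLikelihood ρ x H z p S < θ p then 1 else 0))) +
          ((Fintype.card F : ℝ) ^ d (o p) - 1) / θ p) := by
  set G := (Fintype.card ((i : O) → Fin (d i) → F) : ℝ) with hG
  have hG0 : 0 < G := by rw [hG]; exact_mod_cast Fintype.card_pos
  have hW1 : ∑ x : Fin n → P, ∏ t, π (x t) = 1 := by
    rw [← Fintype.sum_pow, hπ1, one_pow]
  obtain ⟨x, hx⟩ := exists_le_of_weighted_sum_le
    (a := fun x : Fin n → P => K * ∑ p, ∑ S : ChannelState F K,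
        (∑ H : Fin n → ChannelState F K, ∑ z : Fin n → F,
          (Fintype.card (ChannelState F K) : ℝ)⁻¹ ^ n *
            (seqProb ρ z * (if noiseLikelihood ρ x H z p S < θ p then 1 else 0)) +
          ((Fintype.card F : ℝ) ^ d (o p) - 1) / θ p))
    (fun x => Finset.prod_nonneg fun t _ => hπ (x t)) hW1 (le_of_eq rfl)
  obtain ⟨g, hg⟩ := exists_le_of_weighted_sum_le (ι := Fin n → (i : O) → Fin (d i) → F)
    (W := fun _ => (G ^ n)⁻¹)
    (a := fun g => (linearCode o ψ ρ θ x g e hM).errorProb ρ)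
    (fun _ => by positivity)
    (by
      rw [Finset.sum_const, Finset.card_univ, nsmul_eq_mul, Fintype.card_pi]
      simp only [Finset.prod_const, Finset.card_univ, Fintype.card_fin, Nat.cast_pow]
      exact mul_inv_cancel₀ (pow_pos hG0 n).ne')
    (by
      rw [← Finset.mul_sum, inv_mul_le_iff₀ (pow_pos hG0 n)]
      exact sum_errorProb_linearCode_le h0 h1 hθ hM he x)
  refine ⟨x, g, (hg.trans hx).trans (le_of_eq ?_)⟩
  simp only [mul_left_comm _ (K : ℝ)]
  rw [← Finset.mul_sum]
  congr 1
  simp only [Finset.mul_sum]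
  rw [Finset.sum_comm]
  refine Finset.sum_congr rfl fun p _ => ?_
  rw [Finset.sum_comm]
  refine Finset.sum_congr rfl fun S _ => ?_
  simp only [mul_add, Finset.sum_add_distrib, ← Finset.sum_mul, hW1, one_mul, Finset.mul_sum]

end RandomCoding

/-- Reliable transmission of streams whose sizes stay below the mutual information that the phases
offer, provided every receiver can recover its message from the linear combinations it observes. -/
theorem exists_errorProb_lt {F : Type*} [Field F] [Fintype F] [DecidableEq F] {ρ : ℝ} {P O : Type*}
    [Fintype P] [DecidableEq P] [Fintype O] [DecidableEq O] (h0 : 0 ≤ ρ) (h1 : ρ ≤ 1) (K : ℕ)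
    (o : P → O) (ψ : P → ChannelState F K → ChannelState F K) {π : P → ℝ} (hπ : ∀ p, 0 ≤ π p)
    (hπ1 : ∑ p, π p = 1) {δ : ℝ} (hδ : 0 < δ) {ε : ℝ} (hε : 0 < ε) :
    ∃ N : ℕ, ∀ n, N ≤ n → ∀ (d : O → ℕ) (M : Fin K → ℕ)
      (e : (l : Fin K) → Fin (M l) → Streams F K d), (∀ l, 0 < M l) →
      (∀ p, d (o p) = 0 ∨ d (o p) * Real.logb 2 (Fintype.card F : ℝ) ≤ n *
        (π p / Fintype.card (ChannelState F K) *
          (Real.logb 2 (Fintype.card F : ℝ) - noiseEntropy F ρ) - 2 * δ)) →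
      (∀ k (w w' : (l : Fin K) → Fin (M l)), (∀ p S,
        combination o ψ k (fun l => e l (w l)) p S = combination o ψ k (fun l => e l (w' l)) p S) →
        w k = w' k) →
      ∃ c : Code F K n M, c.errorProb ρ < ε := by
  set C := Real.logb 2 (Fintype.card F : ℝ) - noiseEntropy F ρ with hC
  have hq : 0 < (Fintype.card F : ℝ) := zero_lt_one.trans one_lt_card_real
  choose r hr0 hr1 hr using fun (p : P) (S : ChannelState F K) =>
    exists_noiseLikelihood_tail_le h0 h1 K hπ hπ1 hδ p S
  have hδ1 : (2 : ℝ) ^ (-δ) < 1 := Real.rpow_lt_one_of_one_lt_of_neg one_lt_two (by linarith)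
  have hlim : Filter.Tendsto (fun n : ℕ => (K : ℝ) * ∑ p, ∑ S : ChannelState F K,
      (r p S ^ n + ((2 : ℝ) ^ (-δ)) ^ n)) Filter.atTop (nhds 0) := by
    have : Filter.Tendsto (fun n : ℕ => (K : ℝ) * ∑ p, ∑ S : ChannelState F K,
        (r p S ^ n + ((2 : ℝ) ^ (-δ)) ^ n)) Filter.atTop
        (nhds ((K : ℝ) * ∑ _p : P, ∑ _S : ChannelState F K, (0 + 0))) :=
      (tendsto_finsetSum _ fun p _ => tendsto_finsetSum _ fun S _ =>
        (tendsto_pow_atTop_nhds_zero_of_lt_one (hr0 p S) (hr1 p S)).add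
        (tendsto_pow_atTop_nhds_zero_of_lt_one (by positivity) hδ1)).const_mul _
    simpa using this
  obtain ⟨N, hN⟩ := (hlim.eventually (gt_mem_nhds hε)).exists_forall_of_atTop
  refine ⟨N, fun n hn d M e hM hd he => ?_⟩
  obtain ⟨x, g, hxg⟩ := exists_errorProb_linearCode_le (n := n) (ψ := ψ)
    -- The threshold lies `δ` below the typical exponent and the stream size `2 * δ` below it, so
    -- the union bound leaves `2 ^ (-δ * n)`.
    (θ := fun p => (2 : ℝ) ^ ((n : ℝ) * (π p / Fintype.card (ChannelState F K) * C - δ)))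
    h0 h1 (fun p => by positivity) hM he hπ hπ1
  refine ⟨_, hxg.trans_lt (lt_of_le_of_lt ?_ (hN n hn))⟩
  refine mul_le_mul_of_nonneg_left (Finset.sum_le_sum fun p _ => Finset.sum_le_sum fun S _ =>
    add_le_add (hr p S n) ?_) (Nat.cast_nonneg K)
  rcases hd p with h | h
  -- An empty stream has no false combination, so it costs nothing even when its exponent is
  -- negative.
  · rw [h, pow_zero, sub_self, zero_div]
    positivity
  · rw [div_le_iff₀ (by positivity), ← Real.rpow_natCast ((2 : ℝ) ^ (-δ)),
      ← Real.rpow_mul two_pos.le, ← Real.rpow_add two_pos, pow_eq_two_rpow hq]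
    refine (sub_le_self _ zero_le_one).trans (Real.rpow_le_rpow_of_exponent_le one_le_two ?_)
    linarith

/-! ### Ergodic interference alignment -/

section Alignment

variable {F : Type*} [Field F] {K : ℕ}

/-- The complementary channel states: scaling the direct coefficients by `α` and negating all
others pairs every state with one whose interference is opposite. -/
def complement (α : Fˣ) : ChannelState F K ≃ ChannelState F K :=
  Equiv.piCongrRight fun k => Equiv.piCongrRight fun l =>
    Equiv.mulLeft (if k = l then α else -1)

/-- The type of stream sent in a phase: the two phases `inl` serve the aligned stream, and the
phase `inr k` serves the stream of user `k` alone. -/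
def phaseStream : Bool ⊕ Fin K → Option (Fin K)
  | .inl _ => none
  | .inr k => some k

/-- In the second phase, the aligned streams are repeated when the complementary state occurs. -/
def phaseState (α : Fˣ) : Bool ⊕ Fin K → ChannelState F K → ChannelState F K
  | .inl false, S => S
  | .inl true, S => (complement α).symm S
  | .inr _, S => S

/-- The linear combinations observed in both phases cancel the interference. -/
theorem combination_add_combination {d : Option (Fin K) → ℕ} (α : Fˣ)
    (v : Fin K → Streams F K d) (k : Fin K) (S : ChannelState F K) (i : Fin (d none)) :
    combination phaseStream (phaseState α) k v (.inl false) S i +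
      combination phaseStream (phaseState α) k v (.inl true) (complement α S) i =
      (1 + α) * S k k * v k none S i := by
  have h1 : combination phaseStream (phaseState α) k v (.inl false) S =
      ∑ l, (S k l : F) • v l none S := rfl
  have h2 : combination phaseStream (phaseState α) k v (.inl true) (complement α S) =
      ∑ l, (complement α S k l : F) • v l none ((complement α).symm (complement α S)) := rfl
  rw [h1, h2, Equiv.symm_apply_apply, Finset.sum_apply, Finset.sum_apply,
    ← Finset.sum_add_distrib, Finset.sum_eq_single k]
  · simp [complement]
    ring
  · intro l _ hl
    simp [complement, hl.symm]
  · simp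

theorem combination_solo {d : Option (Fin K) → ℕ} (α : Fˣ) {v : Fin K → Streams F K d}
    (hv : ∀ l m, l ≠ m → v l (some m) = 0) (k : Fin K) (S : ChannelState F K) :
    combination phaseStream (phaseState α) k v (.inr k) S = (S k k : F) • v k (some k) S := by
  have h1 : combination phaseStream (phaseState α) k v (.inr k) S =
      ∑ l, (S k l : F) • v l (some k) S := rfl
  rw [h1]
  refine Finset.sum_eq_single k (fun l _ hl => ?_) (by simp)
  rw [hv l k hl, Pi.zero_apply]
  exact smul_zero (S k l : F)

/-- The linear combinations observed by a receiver determine the streams of its own user. -/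
theorem eq_of_combination_eq {d : Option (Fin K) → ℕ} {α : Fˣ}
    (hα : (1 + α : F) ≠ 0 ∨ d none = 0) {v v' : Fin K → Streams F K d}
    (hv : ∀ l m, l ≠ m → v l (some m) = 0) (hv' : ∀ l m, l ≠ m → v' l (some m) = 0) {k : Fin K}
    (h : ∀ p S, combination phaseStream (phaseState α) k v p S =
      combination phaseStream (phaseState α) k v' p S) : v k = v' k := by
  funext i S
  rcases i with _ | m
  · rcases hα with hα | hd
    · funext i
      have := combination_add_combination α v k S i
      rw [h, h, combination_add_combination] at this
      exact (mul_left_cancel₀ (mul_ne_zero hα (S k k).ne_zero) this).symm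
    · have : IsEmpty (Fin (d none)) := by rw [hd]; infer_instance
      exact Subsingleton.elim _ _
  · by_cases hm : k = m
    · subst hm
      have := h (.inr k) S
      rw [combination_solo α hv, combination_solo α hv'] at this
      exact smul_right_injective _ (S k k).ne_zero this
    · rw [hv k m hm, hv' k m hm]

variable [Fintype F]

/-- A counting argument: user `k` may fill the aligned stream and its own solo stream freely in
every state, and stays silent in the solo streams of others. -/
theorem exists_injective_streams [DecidableEq F] {d : Option (Fin K) → ℕ} (k : Fin K) {M : ℕ}
    (hM : M ≤ Fintype.card F ^ (Fintype.card (ChannelState F K) * (d none + d (some k)))) :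
    ∃ e : Fin M → Streams F K d, Function.Injective e ∧ ∀ w m, k ≠ m → e w (some m) = 0 := by
  have hcard : Fintype.card (Fin M) ≤ Fintype.card ((ChannelState F K → Fin (d none) → F) ×
      (ChannelState F K → Fin (d (some k)) → F)) := by
    have h : ∀ j, Fintype.card (ChannelState F K → Fin j → F) =
        Fintype.card F ^ (Fintype.card (ChannelState F K) * j) := fun j => by
      rw [Fintype.card_fun, Fintype.card_fun (α := Fin j), Fintype.card_fin, ← pow_mul, mul_comm]
    rw [Fintype.card_prod, h, h, ← pow_add, ← mul_add, Fintype.card_fin]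
    exact hM
  obtain ⟨f⟩ := Function.Embedding.nonempty_of_card_le hcard
  refine ⟨fun w => Function.update (Function.update 0 none (f w).1) (some k) (f w).2,
    fun w w' h => f.injective (Prod.ext ?_ ?_), fun w m hm => ?_⟩
  · simpa using congrFun h none
  · simpa using congrFun h (some k)
  · simp [Function.update_of_ne, hm.symm]

end Alignment

/-- Rate tuples that satisfy the pairwise constraints are obtained by sharing time between
alignment, for a fraction `2 * a`, and transmission of single users. -/
theorem exists_time_sharing {K q : ℕ} (hK : 2 ≤ K) (hq : 3 ≤ q ∨ K = 2) {C : ℝ} {R : Fin K → ℝ}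
    (hR : ∀ k, 0 ≤ R k) (hRC : ∀ k l, k ≠ l → R k + R l ≤ C) :
    ∃ (a : ℝ) (b : Fin K → ℝ), 0 ≤ a ∧ (∀ k, 0 ≤ b k) ∧ 2 * a + ∑ k, b k = 1 ∧
      (∀ k, R k ≤ (a + b k) * C) ∧ (3 ≤ q ∨ a = 0) := by
  have hne : ∀ k : Fin K, ∃ l, k ≠ l := fun k => by
    have : Nontrivial (Fin K) := Fin.nontrivial_iff_two_le.2 hK
    obtain ⟨l, hl⟩ := exists_ne k
    exact ⟨l, hl.symm⟩
  have hle : ∀ k, R k ≤ C := fun k => by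
    obtain ⟨l, hl⟩ := hne k
    linarith [hRC k l hl, hR l]
  have hC0 : 0 ≤ C := (hR ⟨0, by omega⟩).trans (hle _)
  rcases hC0.eq_or_lt with hC | hC
  · refine ⟨0, Pi.single ⟨0, by omega⟩ 1, le_rfl, fun k => ?_, by simp, fun k => ?_, Or.inr rfl⟩
    · rw [Pi.single_apply]
      split_ifs <;> norm_num
    · rw [← hC, mul_zero, hC]; exact hle k
  rcases hq with hq | rfl
  · by_cases hbig : ∃ k, C / 2 < R k
    · obtain ⟨k, hk⟩ := hbig
      have hk1 : R k / C ≤ 1 := (div_le_one hC).2 (hle k)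
      have hk2 : 1 / 2 < R k / C := by rw [lt_div_iff₀ hC]; linarith
      -- At most one rate exceeds `C / 2`. The choice makes `a + b k = R k / C`, and `a * C = C - R
      -- k` bounds every other rate.
      refine ⟨1 - R k / C, Pi.single k (2 * (R k / C) - 1), by linarith, fun l => ?_, ?_, ?_,
        Or.inl hq⟩
      · rw [Pi.single_apply]
        split_ifs <;> linarith
      · rw [Finset.sum_pi_single' k, if_pos (Finset.mem_univ _)]; ring
      · intro l
        by_cases hl : l = k
        · subst hl
          rw [Pi.single_eq_same]
          refine le_of_eq ?_
          field_simp
          ring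
        · rw [Pi.single_eq_of_ne hl, add_zero, sub_mul, div_mul_cancel₀ _ hC.ne']
          linarith [hRC l k hl]
    · push Not at hbig
      refine ⟨1 / 2, 0, by norm_num, fun _ => le_rfl, by simp, fun k => ?_, Or.inl hq⟩
      have := hbig k
      simp only [Pi.zero_apply]
      linarith
  · refine ⟨0, ![R 0 / C, 1 - R 0 / C], le_rfl, fun k => ?_, by simp, fun k => ?_, Or.inr rfl⟩
    · have h1 : R 0 / C ≤ 1 := (div_le_one hC).2 (hle 0)
      have h2 : 0 ≤ R 0 / C := div_nonneg (hR 0) hC.le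
      fin_cases k <;> simp <;> assumption
    · have := hRC 0 1 (by decide)
      fin_cases k
      · simp [div_mul_cancel₀ _ hC.ne']
      · simp [sub_mul, div_mul_cancel₀ _ hC.ne']
        linarith

/-! ### Assembling the achievability proof -/

section Achievability

variable {F : Type*} [Field F] [Fintype F] [DecidableEq F] {K : ℕ} {ρ : ℝ}

theorem exists_unit_one_add_ne_zero (hq : 3 ≤ Fintype.card F) : ∃ α : Fˣ, (1 + α : F) ≠ 0 := by
  obtain ⟨x, -, hx⟩ := Finset.exists_mem_notMem_of_card_lt_card
    (s := {0, -1}) (t := (Finset.univ : Finset F))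
    ((Finset.card_le_two).trans_lt (by rw [Finset.card_univ]; omega))
  simp only [Finset.mem_insert, Finset.mem_singleton, not_or] at hx
  exact ⟨Units.mk0 x hx.1, fun h => hx.2 (by simp at h; linear_combination h)⟩

theorem achievable_of_add_le (h0 : 0 ≤ ρ) (h1 : ρ ≤ 1) (hK : 2 ≤ K)
    (hq : 3 ≤ Fintype.card F ∨ K = 2) {R : Fin K → ℝ} (hR : ∀ k, 0 ≤ R k)
    (hRC : ∀ k l, k ≠ l → R k + R l ≤ Real.logb 2 (Fintype.card F : ℝ) - noiseEntropy F ρ) :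
    Achievable F K ρ R := by
  intro ε hε
  obtain ⟨a, b, ha, hb, hab, hRab, hqa⟩ := exists_time_sharing hK hq hR hRC
  set C := Real.logb 2 (Fintype.card F : ℝ) - noiseEntropy F ρ with hC
  set L := Real.logb 2 (Fintype.card F : ℝ) with hL
  set s := (Fintype.card (ChannelState F K) : ℝ) with hs
  have hs0 : 0 < s := by rw [hs]; exact_mod_cast Fintype.card_pos
  have hL0 : 0 < L := Real.logb_pos one_lt_two one_lt_card_real
  have hq0 : 0 < (Fintype.card F : ℝ) := zero_lt_one.trans one_lt_card_real
  obtain ⟨α, hα⟩ : ∃ α : Fˣ, (1 + α : F) ≠ 0 ∨ a = 0 := by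
    rcases hqa with h | h
    · obtain ⟨α, hα⟩ := exists_unit_one_add_ne_zero h
      exact ⟨α, Or.inl hα⟩
    · exact ⟨1, Or.inr h⟩
  -- Two streams in each of `s` states lose `2 * δ` each, in total `4 * δ * s = ε / 4`. Rounding
  -- their sizes costs at most another `ε / 4` for large `n`.
  obtain ⟨δ, hδ⟩ : ∃ δ, δ = ε / (16 * s) := ⟨_, rfl⟩
  have hδ0 : 0 < δ := by rw [hδ]; positivity
  have hδs : 16 * (δ * s) = ε := by rw [hδ]; field_simp
  let π : Bool ⊕ Fin K → ℝ := Sum.elim (fun _ => a) b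
  let π' : Option (Fin K) → ℝ := fun i => i.elim a b
  obtain ⟨N, hN⟩ := exists_errorProb_lt (F := F) h0 h1 K phaseStream (phaseState α) (π := π)
    (by rintro (_ | k); exacts [ha, hb k]) (by simp [π]; linarith) hδ0 hε
  obtain ⟨N', hN'⟩ := exists_nat_gt (8 * s * L / ε)
  refine ⟨max N N', fun n hn => ?_⟩
  have hn' : 8 * s * L < n * ε := by
    have h : (N' : ℝ) ≤ n := by exact_mod_cast (le_max_right _ _).trans hn
    exact (div_lt_iff₀ hε).1 (hN'.trans_le h)
  let d : Option (Fin K) → ℕ := fun i => ⌊n * (π' i / s * C - 2 * δ) / L⌋₊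
  have hd : ∀ i, d i = 0 ∨ d i * L ≤ n * (π' i / s * C - 2 * δ) := fun i => by
    rcases Nat.eq_zero_or_pos (d i) with h | h
    · exact Or.inl h
    · refine Or.inr ((le_div_iff₀ hL0).1 (Nat.floor_le ?_))
      by_contra! hneg
      exact h.ne' (Nat.floor_of_nonpos hneg.le)
  have hd' : ∀ i, n * (π' i / s * C - 2 * δ) - L ≤ d i * L := fun i => by
    have := (div_lt_iff₀ hL0).1 (Nat.lt_floor_add_one (n * (π' i / s * C - 2 * δ) / L))
    have h2 : n * (π' i / s * C - 2 * δ) < (d i + 1) * L := this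
    linarith
  let R' : Fin K → ℝ := fun k => max 0 (R k - ε / 2)
  have hrate : ∀ k, n * R' k ≤ s * (d none + d (some k)) * L := fun k => by
    rcases le_total (R k - ε / 2) 0 with h | h
    · rw [show R' k = 0 from max_eq_left h, mul_zero]
      positivity
    · rw [show R' k = R k - ε / 2 from max_eq_right h]
      have h3 := mul_le_mul_of_nonneg_left (add_le_add (hd' none) (hd' (some k))) hs0.le
      have h4 : s * (n * (π' none / s * C - 2 * δ) - L + (n * (π' (some k) / s * C - 2 * δ) - L)) =
          n * ((a + b k) * C - 4 * (δ * s)) - 2 * s * L := by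
        simp only [π', Option.elim]
        field_simp
        ring
      rw [h4] at h3
      have h5 : (n : ℝ) * (R k - ε / 4) ≤ n * ((a + b k) * C - 4 * (δ * s)) :=
        mul_le_mul_of_nonneg_left (by linarith [hRab k]) (Nat.cast_nonneg n)
      linarith
  have hM : ∀ k, ⌊(2 : ℝ) ^ ((n : ℝ) * R' k)⌋₊ ≤
      Fintype.card F ^ (Fintype.card (ChannelState F K) * (d none + d (some k))) := fun k => by
    have h : (2 : ℝ) ^ ((n : ℝ) * R' k) ≤
        ((Fintype.card F ^ (Fintype.card (ChannelState F K) * (d none + d (some k))) : ℕ) : ℝ) := by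
      rw [Nat.cast_pow, pow_eq_two_rpow hq0]
      refine Real.rpow_le_rpow_of_exponent_le one_le_two ((hrate k).trans (le_of_eq ?_))
      push_cast
      rfl
    exact Nat.floor_le_of_le h
  choose e he he0 using fun k => exists_injective_streams k (hM k)
  refine ⟨R', fun k => ⟨le_max_left _ _, lt_of_lt_of_le (by linarith) (le_max_right _ _)⟩,
    hN n ((le_max_left _ _).trans hn) d _ e
      (fun k => Nat.floor_pos.2 (one_le_two_rpow (le_max_left _ _))) ?_ ?_⟩
  · rintro (_ | k)
    · exact hd none
    · exact hd (some k)
  · intro k w w' h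
    refine he k (eq_of_combination_eq (hα.imp_right fun h => ?_) (fun l m hlm => he0 l _ m hlm)
      (fun l m hlm => he0 l _ m hlm) h)
    -- With `a = 0` the argument of the floor is nonpositive, so the aligned stream is empty and no
    -- condition on `α` is needed.
    simp only [d, π', Option.elim, h]
    refine Nat.floor_of_nonpos (div_nonpos_of_nonpos_of_nonneg
      (mul_nonpos_of_nonneg_of_nonpos (Nat.cast_nonneg n) ?_) hL0.le)
    simp [hδ0.le]

end Achievability

end FiniteFieldIC

end

theorem theorem4 {F : Type*} [Field F] [Fintype F] [DecidableEq F] (K : ℕ) (hK : 2 ≤ K)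
    (hq : 3 ≤ Fintype.card F ∨ K = 2) (ρ : ℝ) (hρ0 : 0 ≤ ρ) (hρ1 : ρ ≤ 1) :
    FiniteFieldIC.ergodicCapacityRegion F K ρ =
      {R : Fin K → ℝ | (∀ k, 0 ≤ R k) ∧ ∀ k l : Fin K, k ≠ l →
        R k + R l ≤ Real.logb 2 (Fintype.card F : ℝ) - FiniteFieldIC.noiseEntropy F ρ} := by
  -- The region is closed, so the converse passes to the closure; in the other direction even the
  -- boundary is achievable directly.
  refine Set.Subset.antisymm (closure_minimal ?_ ?_) fun R hR => subset_closure ?_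
  · exact fun R hR => ⟨hR.1, fun k l hkl => hR.2.add_le hρ0 hρ1 hkl⟩
  · simp only [Set.ofPred_and, Set.ofPred_forall]
    refine (isClosed_iInter fun k => isClosed_le continuous_const (continuous_apply k)).inter
      (isClosed_iInter fun k => isClosed_iInter fun l => isClosed_iInter fun _ => ?_)
    exact isClosed_le ((continuous_apply k).add (continuous_apply l)) continuous_const
  · exact ⟨hR.1, FiniteFieldIC.achievable_of_add_le hρ0 hρ1 hK hq hR.1 hR.2⟩
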